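/- For a permutation $\pi=\pi_1\cdots\pi_n$ of $\{1,\dots,n\}$ let $\mathrm{ides}(\pi)$ be the number of descents of $\pi^{-1}$, i.e. the number of $k\in\{1,\dots,n-1\}$ with $\pi^{-1}(k)>\pi^{-1}(k+1)$. For a permutation $\sigma$ of $\{1,\dots,m\}$ let $\mathrm{occ}_\sigma(\pi)$ be the number of occurrences of $\sigma$ in $\pi$ as a consecutive pattern, i.e. the number of positions $j$ with $1\le j\le n-m+1$ such that $\pi_j\pi_{j+1}\cdots\pi_{j+m-1}$ has standardization $\sigma$; $\pi$ avoids $\sigma$ if $\mathrm{occ}_\sigma(\pi)=0$. Put $$A^{\mathrm{ides}}_{\sigma,n}(s,t)=\sum_{\pi\in\mathfrak S_n}s^{\mathrm{occ}_\sigma(\pi)}t^{\mathrm{ides}(\pi)+1}\quad(n\ge 1),\qquad A^{\mathrm{ides}}_{\sigma,0}(s,t)=1,\qquad A^{\mathrm{ides}}_{\sigma,n}(t)=A^{\mathrm{ides}}_{\sigma,n}(0,t).$$ For formal power series in $t$ whose coefficients are power series in $x$ (with coefficients in $\mathbb{Q}[s]$ in (a) and in $\mathbb{Q}$ in (b)),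 let $*$ be the Hadamard product in $t$, $\big(\sum_n a_nt^n\big)*\big(\sum_n b_nt^n\big)=\sum_n a_nb_nt^n$, and let $f^{*\langle n\rangle}$ be the $n$-fold Hadamard product of $f$ with itself, with $f^{*\langle 0\rangle}=1/(1-t)$. All other products and quotients are the ordinary ones. **Theorem.** Let $\sigma=12\cdots(a-1)(a+1)a(a+2)(a+3)\cdots m$, where $m\ge5$ and $2\le a\le m-2$, let $i=\min(a,m-a)$ and $z=x/(1-t)$. Then, as identities of (convergent sums of) formal power series, (a) $$\sum_{n=0}^\infty\frac{A^{\mathrm{ides}}_{\sigma,n}(s,t)}{(1-t)^{n+1}}x^n=\sum_{n=0}^\infty\left(\frac{tx}{(1-t)^2}+\frac{(s-1)t^2z^m}{(1-t)\left(1-(s-1)t\sum_{l=1}^{i}z^{m-l}\right)}\right)^{*\langle n\rangle},$$ (b) $$\sum_{n=0}^\infty\frac{A^{\mathrm{ides}}_{\sigma,n}(t)}{(1-t)^{n+1}}x^n=\sum_{n=0}^\infty\left(\frac{tx}{(1-t)^2}-\frac{t^2z^m}{(1-t)\left(1+t\sum_{l=1}^{i}z^{m-l}\right)}\right)^{*\langle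 n\rangle}.$$ Moreover, for every $n\ge1$, $A^{\mathrm{ides}}_{\sigma,n}(t)=\sum_{\pi}t^{\mathrm{ides}(\pi)+1}$, where $\pi$ runs over the permutations in $\mathfrak S_n$ that avoid $\sigma$. -/

import Mathlib

namespace TransIdes

open Finset

/-! Permutations of `[n]` are `Equiv.Perm (Fin n)`, with positions and letters shifted down by one:
`π ⟨i, _⟩ = j` means that the letter in position `i + 1` is `j + 1`. -/

section Permutations

/-- `des π` is the number of descents of `π`, that is, of positions `i` with `π i > π (i + 1)`. -/
def des {n : ℕ} (π : Equiv.Perm (Fin n)) : ℕ :=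
  #{i : Fin n | ∃ h : i.val + 1 < n, π ⟨i.val + 1, h⟩ < π i}

/-- The inverse descent number. -/
def ides {n : ℕ} (π : Equiv.Perm (Fin n)) : ℕ := des π⁻¹

/-- Standardization of a sequence of distinct numbers: the smallest letter is replaced by `0`, the
second smallest by `1`, and so on. -/
def std {m : ℕ} (w : Fin m → ℕ) (j : Fin m) : ℕ := #{k : Fin m | w k < w j}

/-- The `m` consecutive letters of `π` that start at position `i` are an occurrence of `σ`. -/
def IsOccurrence {m n : ℕ} (σ : Equiv.Perm (Fin m)) (π : Equiv.Perm (Fin n)) (i : ℕ) : Prop :=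
  ∃ h : i + m ≤ n,
    ∀ j : Fin m, std (fun k : Fin m => (π ⟨i + k.val, by omega⟩).val) j = (σ j).val

instance {m n : ℕ} (σ : Equiv.Perm (Fin m)) (π : Equiv.Perm (Fin n)) (i : ℕ) :
    Decidable (IsOccurrence σ π i) := by
  unfold IsOccurrence; infer_instance

/-- `occ σ π` is the number of occurrences of `σ` in `π` as a consecutive pattern. -/
def occ {m n : ℕ} (σ : Equiv.Perm (Fin m)) (π : Equiv.Perm (Fin n)) : ℕ :=
  #{i ∈ range (n + 1) | IsOccurrence σ π i}

/-- `π` avoids `σ` as a consecutive pattern. -/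
def Avoids {m n : ℕ} (σ : Equiv.Perm (Fin m)) (π : Equiv.Perm (Fin n)) : Prop := occ σ π = 0

instance {m n : ℕ} (σ : Equiv.Perm (Fin m)) (π : Equiv.Perm (Fin n)) :
    Decidable (Avoids σ π) := by
  unfold Avoids; infer_instance

/-- The permutation `1 2 ⋯ (a-1) (a+1) a (a+2) ⋯ m`, which exchanges `a` and `a + 1`. -/
def transPattern (m a : ℕ) (ha : 1 ≤ a) (ham : a < m) : Equiv.Perm (Fin m) :=
  Equiv.swap ⟨a - 1, by omega⟩ ⟨a, ham⟩

/-- The polynomial `A_{σ,n}(s,t) = ∑_{π ∈ S_n} s ^ occ_σ(π) * t ^ (ides(π) + 1)` for `n ≥ 1`, and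
`1` for `n = 0`, evaluated at elements `s`, `t` of a commutative ring. -/
def idesPoly {R : Type*} [CommSemiring R] {m : ℕ} (σ : Equiv.Perm (Fin m)) (n : ℕ) (s t : R) : R :=
  if n = 0 then 1 else ∑ π : Equiv.Perm (Fin n), s ^ occ σ π * t ^ (ides π + 1)

end Permutations

section Series

variable {K : Type*} [CommRing K]

/-- Formal power series in `t` and `x` over `K`, written as series in `t` whose coefficients are
series in `x`. -/
abbrev Series (K : Type*) [CommRing K] : Type _ := PowerSeries (PowerSeries K)

noncomputable def tVar : Series K := PowerSeries.X

noncomputable def xVar : Series K := PowerSeries.C PowerSeries.X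

noncomputable def sVar : Series (Polynomial ℚ) := PowerSeries.C (PowerSeries.C Polynomial.X)

/-- `1/(1-t)` -/
noncomputable def geom : Series K := Ring.inverse (1 - tVar)

/-- `z = x/(1-t)` -/
noncomputable def zVar : Series K := xVar * geom

/-- The Hadamard product in `t`; coefficients in `x` are multiplied as usual. -/
noncomputable def hadamard (f g : Series K) : Series K :=
  PowerSeries.mk fun n => PowerSeries.coeff n f * PowerSeries.coeff n g

/-- The `n`-fold Hadamard product `f * ⋯ * f`. The empty one is the identity `1/(1-t)`. -/
noncomputable def hadamardPow (f : Series K) : ℕ → Series K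
  | 0 => geom
  | n + 1 => hadamard (hadamardPow f n) f

/-- `F = ∑_{n ≥ 0} f n` as formal power series: each coefficient of the partial sums is eventually
constant and equal to that of `F`. -/
def IsFormalSum (f : ℕ → Series K) (F : Series K) : Prop :=
  ∀ i j : ℕ, ∀ᶠ N in Filter.atTop,
    PowerSeries.coeff j (PowerSeries.coeff i (∑ n ∈ range N, f n)) =
      PowerSeries.coeff j (PowerSeries.coeff i F)

/-- Every `1 - t * f` is invertible, so that all uses of `Ring.inverse` here are true inverses. -/
theorem isUnit_one_sub_tVar_mul (f : Series K) : IsUnit (1 - tVar * f) := by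
  rw [PowerSeries.isUnit_iff_constantCoeff]
  simp [tVar]

end Series

end TransIdes

open TransIdes

/-! Compare coefficients of `t^k`. A word in `k` letters has the same inversions as `π`, the inverse
of its stable sort `τ`, hence the same occurrences of the pattern. The words of length `n` sorted by
a given `τ` have generating function `t^(des τ + 1)/(1-t)^(n+1)` (`coeff_card_sort_eq`). So the
left-hand coefficient enumerates words by length and occurrences (`wordSeries`). On the right,
Hadamard products multiply coefficients, which leaves a geometric series with ratio `k x + (s-1) *
(clusters)`. Their equality is the Goulden–Jackson cluster method for words, `wordSeries_mul`.

Clusters are computable because two occurrences share at most `min(a, m-a)` letters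
(`WordOcc.overlap`), and the words with occurrences at every place of a cluster `T` of length `L`
are exactly those sorted by one product of `#T` disjoint adjacent transpositions
(`IsCluster.forall_wordOcc_iff`, `IsCluster.exists_perm`). They contribute `t^(#T+1) z^L/(1-t)`, and
a further occurrence sharing `l` letters multiplies this by `t z^(m-l)`. Instead of summing over
sets of marks, the proof writes `s = 1 + (s-1)` at one position after another. -/

namespace TransIdes
open Finset

/-! ### Occurrences as conditions on inversions, and stable sorting -/

section Standardization

/-- The word `w` has an occurrence at `p` of the pattern which exchanges `a` and `a + 1`: the only
inversion of `w` between positions `p` and `p + m` is `(p + a - 1, p + a)`. -/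
def WordOcc (m a : ℕ) {n : ℕ} (w : Fin n → ℕ) (p : ℕ) : Prop :=
  p + m ≤ n ∧ ∀ x y : Fin n, p ≤ x → x < y → y < p + m →
    (w y < w x ↔ (x : ℕ) + 1 = p + a ∧ (y : ℕ) = p + a)

theorem std_lt_std_iff {m : ℕ} (u : Fin m → ℕ) (j k : Fin m) : std u k < std u j ↔ u k < u j := by
  constructor
  · intro h
    by_contra! hle
    exact absurd h (not_lt.2 (card_le_card fun x hx => by
      simp only [mem_filter, mem_univ, true_and] at hx ⊢; omega))
  · intro h
    refine card_lt_card ⟨fun x hx => ?_, fun hss => ?_⟩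
    · simp only [mem_filter, mem_univ, true_and] at hx ⊢; omega
    · have := @hss k (by simpa using h)
      simp at this

/-- If `u` and `σ` are ordered alike, then `σ` carries the letters below `u j` onto `Iio (σ j)`, so
the rank of `u j` is `σ j`. -/
theorem std_eq_iff {m : ℕ} (u : Fin m → ℕ) (hu : Function.Injective u) (σ : Equiv.Perm (Fin m)) :
    (∀ j, std u j = (σ j).val) ↔ ∀ j k, j < k → (u k < u j ↔ σ k < σ j) := by
  constructor
  · intro h j k _
    rw [← std_lt_std_iff u, h, h, Fin.lt_def]
  · intro h j
    have key : ∀ k, u k < u j ↔ σ k < σ j := by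
      intro k
      rcases lt_trichotomy j k with hjk | rfl | hjk
      · exact h j k hjk
      · simp
      · have h1 := h k j hjk
        have h2 : u k ≠ u j := hu.ne hjk.ne
        have h3 : σ k ≠ σ j := σ.injective.ne hjk.ne
        rw [Fin.lt_def] at *
        have h4 : (σ k).val ≠ (σ j).val := fun e => h3 (Fin.ext e)
        omega
    have : (univ.filter fun k => u k < u j).map σ.toEmbedding = Iio (σ j) := by
      ext y
      simp only [mem_map, mem_filter, mem_univ, true_and, key, mem_Iio, Equiv.coe_toEmbedding]
      exact ⟨by rintro ⟨x, hx, rfl⟩; exact hx, fun hy => ⟨σ.symm y, by simpa using hy, by simp⟩⟩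
    have h2 := congrArg card this
    rw [card_map, Fin.card_Iio] at h2
    exact h2

theorem isOccurrence_transPattern_iff {m n a : ℕ} (ha : 1 ≤ a) (ham : a < m)
    (π : Equiv.Perm (Fin n)) (p : ℕ) :
    IsOccurrence (transPattern m a ha ham) π p ↔ WordOcc m a (fun x => (π x).val) p := by
  unfold IsOccurrence WordOcc
  rw [← exists_prop]
  refine exists_congr fun h => ?_
  rw [std_eq_iff]
  · have hs : ∀ j k : Fin m, j < k →
        (transPattern m a ha ham k < transPattern m a ha ham j ↔
          (j : ℕ) + 1 = a ∧ (k : ℕ) = a) := by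
      intro j k hjk
      simp only [transPattern, Equiv.swap_apply_def, Fin.ext_iff, Fin.lt_def] at *
      split_ifs <;> simp <;> omega
    constructor
    · intro H x y hx hxy hy
      rw [Fin.lt_def] at hxy
      have := H ⟨x - p, by omega⟩ ⟨y - p, by omega⟩ (by rw [Fin.lt_def]; simp; omega)
      rw [hs _ _ (by rw [Fin.lt_def]; simp; omega)] at this
      have e1 : p + (x.val - p) = x := by omega
      have e2 : p + (y.val - p) = y := by omega
      simp only [e1, e2] at this
      rw [this]
      omega
    · intro H j k hjk
      rw [hs _ _ hjk]
      rw [Fin.lt_def] at hjk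
      have := H ⟨p + j, by omega⟩ ⟨p + k, by omega⟩ (by simp) (by rw [Fin.lt_def]; simp; omega)
        (by simp)
      rw [this]
      simp only
      omega
  · intro x y hxy
    have := π.injective (Fin.ext hxy)
    simp only [Fin.mk.injEq] at this
    exact Fin.ext (by omega)

/-- A permutation sorts a word stably if and only if its inverse has the same inversions. -/
theorem sort_eq_iff {n : ℕ} (w : Fin n → ℕ) (τ : Equiv.Perm (Fin n)) :
    Tuple.sort w = τ ↔ ∀ x y, x < y → (w y < w x ↔ τ⁻¹ y < τ⁻¹ x) := by
  rw [eq_comm, Tuple.eq_sort_iff]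
  constructor
  · rintro ⟨hm, hs⟩ x y hxy
    constructor
    · intro h
      by_contra! hle
      have := hm hle
      simp at this
      omega
    · intro h
      have h1 := hm h.le
      have h2 := hs _ _ h
      simp at h1 h2
      rcases h1.lt_or_eq with h1 | h1
      · exact h1
      · exact absurd (h2 h1) (not_lt.2 hxy.le)
  · intro H
    have key : ∀ i j, i < j → w (τ i) ≤ w (τ j) ∧ (w (τ i) = w (τ j) → τ i < τ j) := by
      intro i j hij
      rcases lt_trichotomy (τ i) (τ j) with h | h | h
      · have := H _ _ h
        simp only [Equiv.Perm.inv_def, Equiv.symm_apply_apply] at this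
        refine ⟨?_, fun _ => h⟩
        by_contra! hc
        exact absurd (this.1 hc) (not_lt.2 hij.le)
      · exact absurd (τ.injective h) hij.ne
      · have := H _ _ h
        simp only [Equiv.Perm.inv_def, Equiv.symm_apply_apply] at this
        have := this.2 hij
        exact ⟨this.le, fun e => absurd e this.ne⟩
    refine ⟨fun i j hij => ?_, fun i j hij => (key i j hij).2⟩
    rcases hij.lt_or_eq with h | rfl
    · exact (key i j h).1
    · rfl

/-- `WordOcc` depends on a word only through its inversions, so it passes between words with
repeated letters and permutations. -/
theorem wordOcc_sort_inv_iff {m a n : ℕ} (w : Fin n → ℕ) (p : ℕ) :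
    WordOcc m a (fun x => ((Tuple.sort w)⁻¹ x).val) p ↔ WordOcc m a w p := by
  unfold WordOcc
  refine and_congr_right fun _ => forall_congr' fun x => forall_congr' fun y =>
    imp_congr_right fun _ => forall_congr' fun hxy => imp_congr_right fun _ => ?_
  rw [(sort_eq_iff w _).1 rfl x y hxy, Fin.lt_def]

end Standardization

/-! ### Counting words with prescribed minimal gaps -/

section Chains

/-- The words of length `n` in the letters `0, …, k - 1`. -/
def words (k n : ℕ) : Finset (Fin n → ℕ) := Fintype.piFinset fun _ => range k

theorem mem_words {k n : ℕ} {w : Fin n → ℕ} : w ∈ words k n ↔ ∀ x, w x < k := by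
  simp [words]

/-- The letter at `y > 0` exceeds its left neighbour by at least `e y`. -/
def IsChain (e : ℕ → ℕ) {n : ℕ} (v : Fin n → ℕ) : Prop :=
  ∀ x y : Fin n, x.val + 1 = y → v x + e y ≤ v y

theorem IsChain.monotone {e : ℕ → ℕ} {n : ℕ} {v : Fin n → ℕ} (h : IsChain e v) : Monotone v := by
  rintro ⟨x, hx⟩ ⟨y, hy⟩ hxy
  simp only [Fin.mk_le_mk] at hxy
  induction y, hxy using Nat.le_induction with
  | base => rfl
  | succ y hxy ih =>
    have := h ⟨y, by omega⟩ ⟨y + 1, hy⟩ rfl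
    exact (ih (by omega)).trans (by omega)

open Classical in
/-- The number of chains in `words k n`. -/
noncomputable def chainCount (e : ℕ → ℕ) (n k : ℕ) : ℕ := #{v ∈ words k n | IsChain e v}

theorem chainCount_zero (e : ℕ → ℕ) (k : ℕ) : chainCount e 0 k = 1 := by
  classical
  unfold chainCount
  rw [filter_true_of_mem (fun v _ x => x.elim0)]
  simp [words]

theorem chainCount_succ_zero (e : ℕ → ℕ) (n : ℕ) : chainCount e (n + 1) 0 = 0 := by
  classical
  simp [chainCount, words]

/-- Split on whether the last and largest letter is below `k` or equal to `k`; in the latter case,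
delete it. -/
theorem chainCount_succ_succ (e : ℕ → ℕ) (n k : ℕ) (he : e n ≤ 1) :
    chainCount e (n + 1) (k + 1) = chainCount e (n + 1) k + chainCount e n (k + 1 - e n) := by
  classical
  unfold chainCount
  rw [← card_filter_add_card_filter_not (s := {v ∈ words (k + 1) (n + 1) | IsChain e v})
    (fun v => v (Fin.last n) < k)]
  congr 1
  · congr 1
    ext v
    simp only [mem_filter, mem_words]
    constructor
    · rintro ⟨⟨_, h2⟩, h3⟩
      exact ⟨fun x => (h2.monotone (Fin.le_last x)).trans_lt h3, h2⟩
    · rintro ⟨h1, h2⟩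
      exact ⟨⟨fun x => (h1 x).trans (by omega), h2⟩, h1 _⟩
  · refine card_nbij' (fun v => fun x => v x.castSucc) (fun v => Fin.snoc (α := fun _ => ℕ) v k)
      ?_ ?_ ?_ ?_
    · intro v hv
      simp only [coe_filter, Set.mem_ofPred_eq, mem_filter, mem_words] at hv ⊢
      obtain ⟨⟨h1, h2⟩, h3⟩ := hv
      refine ⟨fun x => ?_, fun x y hxy => h2 x.castSucc y.castSucc (by simpa using hxy)⟩
      obtain ⟨n, rfl⟩ : ∃ l, n = l + 1 := ⟨n - 1, by have := x.isLt; omega⟩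
      have h4 := h2 (Fin.last n).castSucc (Fin.last (n + 1)) (by simp)
      have h5 := h2.monotone (Fin.castSucc_le_castSucc_iff.2 (Fin.le_last x))
      have h6 := h1 (Fin.last _)
      simp only [Fin.val_last] at h4
      omega
    · intro v hv
      simp only [coe_filter, Set.mem_ofPred_eq, mem_filter, mem_words] at hv ⊢
      obtain ⟨h1, h2⟩ := hv
      refine ⟨⟨fun x => ?_, fun x y hxy => ?_⟩, by simp⟩
      · refine Fin.lastCases ?_ (fun x => ?_) x
        · simp
        · simpa using (h1 x).trans_le (Nat.sub_le _ _)
      · revert hxy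
        refine Fin.lastCases ?_ (fun x => ?_) x
        · intro hxy
          have := y.isLt
          simp at hxy
          omega
        · refine Fin.lastCases ?_ (fun y => ?_) y
          · intro _
            have := h1 x
            simp
            omega
          · intro hxy
            simpa using h2 x y (by simpa using hxy)
    · intro v hv
      simp only [coe_filter, Set.mem_ofPred_eq, mem_filter, mem_words] at hv
      funext x
      refine Fin.lastCases ?_ (fun x => ?_) x
      · have := hv.1.1 (Fin.last n)
        simp
        omega
      · simp
    · intro v _
      funext x
      simp

variable {K : Type*} [CommRing K]

theorem geom_mul : (geom : Series K) * (1 - tVar) = 1 :=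
  Ring.inverse_mul_cancel _ (by simpa using isUnit_one_sub_tVar_mul (1 : Series K))

theorem geom_eq : (geom : Series K) = 1 + tVar * geom := by
  linear_combination geom_mul (K := K)

/-- Both sides satisfy the same Pascal-type recursion. The value `e 0` constrains no chain; setting
it to `1` supplies the factor `t` that makes a nonempty word impossible for `k = 0`. -/
theorem coeff_chainCount (e : ℕ → ℕ) (he₀ : e 0 = 1) (he : ∀ j, e j ≤ 1) (n k : ℕ) :
    PowerSeries.coeff k ((tVar : Series K) ^ (∑ j ∈ range n, e j) * geom ^ (n + 1)) =
      (chainCount e n k : PowerSeries K) := by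
  induction n generalizing k with
  | zero =>
    simp only [range_zero, sum_empty, pow_zero, zero_add, pow_one, one_mul, chainCount_zero,
      Nat.cast_one]
    induction k with
    | zero => rw [geom_eq]; simp [tVar]
    | succ k ih => rw [geom_eq, tVar, map_add, PowerSeries.coeff_succ_X_mul, ih]; simp
  | succ n ih =>
    have hrec : (tVar : Series K) ^ (∑ j ∈ range (n + 1), e j) * geom ^ (n + 1 + 1) =
        tVar ^ e n * (tVar ^ (∑ j ∈ range n, e j) * geom ^ (n + 1)) +
        tVar * (tVar ^ (∑ j ∈ range (n + 1), e j) * geom ^ (n + 1 + 1)) := by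
      rw [sum_range_succ]
      linear_combination (tVar : Series K) ^ (∑ j ∈ range n, e j + e n) * geom ^ (n + 1) *
        geom_mul (K := K)
    have h1 : ∀ k, PowerSeries.coeff (k + 1)
        (tVar ^ e n * ((tVar : Series K) ^ (∑ j ∈ range n, e j) * geom ^ (n + 1))) =
        (chainCount e n (k + 1 - e n) : PowerSeries K) := by
      intro k
      have := he n
      interval_cases h : e n
      · simp [ih]
      · rw [pow_one, tVar, PowerSeries.coeff_succ_X_mul, ← tVar, ih]; rfl
    induction k with
    | zero =>
      rw [chainCount_succ_zero, sum_range_succ', he₀, pow_succ, mul_assoc, mul_left_comm, tVar,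
        PowerSeries.coeff_zero_X_mul, Nat.cast_zero]
    | succ k ihk =>
      rw [hrec, map_add, h1, tVar, PowerSeries.coeff_succ_X_mul, ← tVar, ihk,
        chainCount_succ_succ _ _ _ (he n)]
      push_cast
      ring

end Chains

/-! ### Words with a given stable sort -/

section Sorting

/-- The gaps forced on a sorted word by stability. -/
def desGap {n : ℕ} (τ : Equiv.Perm (Fin n)) (j : ℕ) : ℕ :=
  if j = 0 ∨ ∃ x y : Fin n, x.val + 1 = y ∧ y.val = j ∧ τ y < τ x then 1 else 0

theorem sum_desGap {n : ℕ} (hn : n ≠ 0) (τ : Equiv.Perm (Fin n)) :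
    ∑ j ∈ range n, desGap τ j = des τ + 1 := by
  obtain ⟨n, rfl⟩ : ∃ l, n = l + 1 := ⟨n - 1, by omega⟩
  rw [sum_range_succ']
  congr 1
  · unfold desGap des
    rw [← card_filter]
    refine card_nbij' (fun j => Fin.ofNat (n + 1) j) (fun x => x.val) ?_ ?_ ?_ ?_
    · intro j hj
      simp only [coe_filter, mem_range, Set.mem_ofPred_eq, mem_univ, true_and] at hj ⊢
      obtain ⟨hjn, hj⟩ := hj
      obtain ⟨x, y, h1, h2, h3⟩ := hj.resolve_left (by omega)
      have hx : Fin.ofNat (n + 1) j = x := by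
        ext; simp [Fin.ofNat, Nat.mod_eq_of_lt (show j < n + 1 by omega)]; omega
      rw [hx]
      refine ⟨by omega, ?_⟩
      convert h3
    · intro x hx
      simp only [coe_filter, mem_range, Set.mem_ofPred_eq, mem_univ, true_and] at hx ⊢
      obtain ⟨h, hx⟩ := hx
      exact ⟨by omega, Or.inr ⟨x, ⟨x + 1, h⟩, rfl, rfl, hx⟩⟩
    · intro j hj
      simp only [coe_filter, mem_range, Set.mem_ofPred_eq] at hj
      simp [Fin.ofNat, Nat.mod_eq_of_lt (show j < n + 1 by omega)]
    · intro x _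
      ext
      simp [Fin.ofNat]
      omega

/-- Equal letters of a sorted word are contiguous, so stability need only be checked between
neighbours: it forces a strict increase exactly at the descents of `τ`. -/
theorem sort_eq_iff_isChain {n : ℕ} (w : Fin n → ℕ) (τ : Equiv.Perm (Fin n)) :
    Tuple.sort w = τ ↔ IsChain (desGap τ) (w ∘ τ) := by
  rw [eq_comm, Tuple.eq_sort_iff]
  constructor
  · rintro ⟨hm, hs⟩ x y hxy
    have hlt : x < y := by rw [Fin.lt_def]; omega
    have h1 := hm hlt.le
    unfold desGap
    split_ifs with h
    · obtain ⟨x', y', e1, e2, h3⟩ := h.resolve_left (by omega)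
      obtain rfl : x' = x := Fin.ext (by omega)
      obtain rfl : y' = y := Fin.ext (by omega)
      have h2 := hs x' y' hlt
      rcases h1.lt_or_eq with h1 | h1
      · exact h1
      · exact absurd (h2 h1) (not_lt.2 h3.le)
    · exact h1
  · intro h
    refine ⟨h.monotone, ?_⟩
    rintro ⟨x, hx⟩ ⟨y, hy⟩ hxy
    simp only [Fin.mk_lt_mk] at hxy
    induction y, (show x + 1 ≤ y from hxy) using Nat.le_induction with
    | base =>
      intro e
      by_contra! hle
      have h1 := h ⟨x, hx⟩ ⟨x + 1, hy⟩ rfl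
      have h2 : τ ⟨x + 1, hy⟩ < τ ⟨x, hx⟩ := lt_of_le_of_ne hle (τ.injective.ne (by simp))
      have h3 : desGap τ (x + 1) = 1 := if_pos (Or.inr ⟨_, _, rfl, rfl, h2⟩)
      simp only [Function.comp, h3] at h1
      omega
    | succ y hxy ih =>
      intro e
      have h4 := h.monotone (show (⟨x, hx⟩ : Fin n) ≤ ⟨y, by omega⟩ by simp; omega)
      have h1 := h ⟨y, by omega⟩ ⟨y + 1, hy⟩ rfl
      simp only [Function.comp] at h1 h4
      have h5 := ih (by omega) (by omega) (by omega)
      refine h5.trans ?_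
      by_contra! hle
      have h2 : τ ⟨y + 1, hy⟩ < τ ⟨y, by omega⟩ :=
        lt_of_le_of_ne hle (τ.injective.ne (by simp))
      have h3 : desGap τ (y + 1) = 1 := if_pos (Or.inr ⟨_, _, rfl, rfl, h2⟩)
      simp only [h3] at h1
      omega

theorem coeff_card_sort_eq {K : Type*} [CommRing K] {n : ℕ} (hn : n ≠ 0) (k : ℕ)
    (τ : Equiv.Perm (Fin n)) :
    PowerSeries.coeff k ((tVar : Series K) ^ (des τ + 1) * geom ^ (n + 1)) =
      (#{w ∈ words k n | Tuple.sort w = τ} : PowerSeries K) := by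
  classical
  rw [← sum_desGap hn, coeff_chainCount _ (by simp [desGap])
    (fun j => by unfold desGap; split_ifs <;> simp), chainCount]
  congr 1
  symm
  refine card_nbij' (fun w => w ∘ τ) (fun v => v ∘ τ.symm) ?_ ?_ ?_ ?_
  · intro w hw
    simp only [coe_filter, Set.mem_ofPred_eq, mem_words, sort_eq_iff_isChain] at hw ⊢
    exact ⟨fun x => hw.1 _, hw.2⟩
  · intro v hv
    simp only [coe_filter, Set.mem_ofPred_eq, mem_words, sort_eq_iff_isChain] at hv ⊢
    refine ⟨fun x => hv.1 _, ?_⟩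
    convert hv.2
    ext; simp
  · intro w _
    ext; simp
  · intro v _
    ext; simp

end Sorting

/-! ### Clusters and the words that realize them -/

section Clusters

/-- The sets of starting positions of clusters of overlapping occurrences, with the last position
singled out. -/
inductive IsCluster (m i : ℕ) : ℕ → Finset ℕ → Prop
  | single : IsCluster m i 0 {0}
  | insert {p : ℕ} {T : Finset ℕ} {l : ℕ} : IsCluster m i p T → l ∈ Icc 1 i →
      IsCluster m i (p + m - l) (insert (p + m - l) T)

theorem IsCluster.mem {m i p : ℕ} {T : Finset ℕ} (h : IsCluster m i p T) : p ∈ T := by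
  cases h <;> simp

variable {m a i : ℕ}

theorem IsCluster.le {p : ℕ} {T : Finset ℕ} (h : IsCluster m i p T) (him : i < m) {q : ℕ}
    (hq : q ∈ T) : q ≤ p := by
  induction h with
  | single => simp at hq; omega
  | insert h hl ih =>
    simp only [mem_Icc, Finset.mem_insert] at hl hq
    rcases hq with rfl | hq
    · rfl
    · have := ih hq
      omega

theorem IsCluster.notMem {p q : ℕ} {T : Finset ℕ} (h : IsCluster m i p T) (him : i < m)
    (hq : p < q) : q ∉ T :=
  fun hm => absurd (h.le him hm) (by omega)

/-- Each new start lies at least `m - i` beyond the previous last one. -/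
theorem IsCluster.gap {p : ℕ} {T : Finset ℕ} (h : IsCluster m i p T) (him : i < m) {q r : ℕ}
    (hq : q ∈ T) (hr : r ∈ T) (hqr : q < r) : q + m ≤ r + i := by
  induction h with
  | single => simp at hq hr; omega
  | insert h hl ih =>
    simp only [mem_Icc, Finset.mem_insert] at hl hq hr
    have h1 : ∀ x, x ∈ _ → _ := fun x => h.le him (q := x)
    rcases hq with rfl | hq <;> rcases hr with rfl | hr
    · omega
    · have := h1 _ hr
      omega
    · have := h1 _ hq
      omega
    · exact ih hq hr

/-- The words in which all positions of a cluster are occurrences have as inversions only the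
adjacent exchanges of these occurrences. -/
theorem IsCluster.forall_wordOcc_iff {p : ℕ} {T : Finset ℕ} (h : IsCluster m i p T) (hm : 5 ≤ m)
    (ha : 2 ≤ a) (ham : a + 2 ≤ m) (hia : i ≤ a) (hi : i + a ≤ m) {n : ℕ} (hn : p + m ≤ n)
    (w : Fin n → ℕ) :
    (∀ q ∈ T, WordOcc m a w q) ↔ ∀ x y : Fin n, x < y → y < p + m →
      (w y < w x ↔ (x : ℕ) + 1 = y ∧ ∃ q ∈ T, q + a = y) := by
  have him : i < m := by omega
  constructor
  · intro hw
    induction h with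
    | single =>
      intro x y hxy hy
      rw [(hw 0 (by simp)).2 x y (Nat.zero_le _) hxy hy]
      simp
      omega
    | @insert p T l hT hl ih =>
      simp only [mem_Icc] at hl
      have ih := ih (by omega) (fun q hq => hw q (Finset.mem_insert_of_mem hq))
      have hq := (hw _ (Finset.mem_insert_self _ _)).2
      have hle : ∀ q, q ∈ T → q ≤ p := fun q => hT.le him
      intro x y hxy hy
      have hxy' : x.val < y.val := hxy
      by_cases hyp : y.val < p + m
      · rw [ih x y hxy hyp]
        simp only [Finset.mem_insert, exists_eq_or_imp]
        refine and_congr_right fun _ => ⟨Or.inr, fun h => h.resolve_left (by omega)⟩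
      have hyT : ¬ ∃ q ∈ T, q + a = y := by
        rintro ⟨q, h1, h2⟩
        have := hle q h1
        omega
      simp only [Finset.mem_insert, exists_eq_or_imp, hyT, or_false]
      by_cases hxq : p + m - l ≤ x.val
      · rw [hq x y hxq hxy hy]
        omega
      -- Compare `x` and `y` through a position `c` in the overlap that is not exchanged with
      -- either. The choice `p + m - 1` fails only if `l = a`, where it may be exchanged with `y`.
      -- Then the first overlap position serves, unless it is `p + a`, where `m = 2 * a`; its
      -- successor works because `5 ≤ m` gives `a ≥ 3`.
      have hmid : ∃ c : Fin n, p + m - l ≤ c.val ∧ c.val < p + m ∧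
          ¬ (x.val + 1 = c ∧ c = p + a) ∧ ¬ (c.val + 1 = p + m - l + a ∧ y.val = p + m - l + a) := by
        by_cases h1 : p + m = p + m - l + a
        · by_cases h2 : p + m - l = p + a
          · exact ⟨⟨p + m - l + 1, by omega⟩, by simp; omega⟩
          · exact ⟨⟨p + m - l, by omega⟩, by simp; omega⟩
        · exact ⟨⟨p + m - 1, by omega⟩, by simp; omega⟩
      obtain ⟨c, hc1, hc2, hc3, hc4⟩ := hmid
      have h1 : w x ≤ w c := by
        have := ih x c (by rw [Fin.lt_def]; omega) hc2
        by_contra! hlt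
        obtain ⟨e, q, hqT, hqc⟩ := this.1 hlt
        have := hle q hqT
        omega
      have h2 : w c ≤ w y := by
        have := hq c y hc1 (by rw [Fin.lt_def]; omega) hy
        by_contra! hlt
        exact hc4 (this.1 hlt)
      omega
  · intro H q hq
    have hqp := h.le him hq
    refine ⟨by omega, fun x y hx hxy hy => ?_⟩
    rw [H x y hxy (by omega)]
    have hxy' : x.val < y.val := hxy
    constructor
    -- The bounds `i ≤ a` and `i ≤ m - a` keep the exchanged pair of any other cluster member from
    -- lying inside the window of `q`.
    · rintro ⟨h1, r, hr, h2⟩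
      rcases lt_trichotomy q r with h3 | rfl | h3
      · have := h.gap him hq hr h3
        omega
      · omega
      · have := h.gap him hr hq h3
        omega
    · rintro ⟨h1, h2⟩
      exact ⟨by omega, q, hq, h2.symm⟩

open Classical in
/-- The exchange of the letters `q + a - 1` and `q + a` for each `q` in the cluster. -/
noncomputable def clusterSwap (a : ℕ) (T : Finset ℕ) (x : ℕ) : ℕ :=
  if ∃ q ∈ T, q + a = x + 1 then x + 1 else if ∃ q ∈ T, q + a = x then x - 1 else x

/-- Starts in a cluster are never adjacent, since `m - i ≥ a ≥ 2`. Hence the exchanges are disjoint,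
and their product is an involution with one descent per start. -/
theorem IsCluster.exists_perm {p : ℕ} {T : Finset ℕ} (h : IsCluster m i p T) (hm : 5 ≤ m)
    (ha : 2 ≤ a) (ham : a + 2 ≤ m) (hia : i ≤ a) (hi : i + a ≤ m) :
    ∃ τ : Equiv.Perm (Fin (p + m)), des τ = #T ∧ ∀ x y, x < y →
      (τ⁻¹ y < τ⁻¹ x ↔ (x : ℕ) + 1 = y ∧ ∃ q ∈ T, q + a = y) := by
  classical
  have him : i < m := by omega
  have hle : ∀ q ∈ T, q ≤ p := fun q => h.le him
  have hgap : ∀ q ∈ T, ∀ r ∈ T, q + 1 ≠ r := by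
    intro q hq r hr e
    have := h.gap him hq hr (by omega)
    omega
  have hsw : ∀ x, (∃ q ∈ T, q + a = x + 1 ∧ clusterSwap a T x = x + 1) ∨
      (∃ q ∈ T, q + a = x ∧ (clusterSwap a T x) + 1 = x) ∨
      ((∀ q ∈ T, q + a ≠ x + 1 ∧ q + a ≠ x) ∧ clusterSwap a T x = x) := by
    intro x
    unfold clusterSwap
    split_ifs with h1 h2
    · obtain ⟨q, hq, e⟩ := h1
      exact Or.inl ⟨q, hq, e, rfl⟩
    · obtain ⟨q, hq, e⟩ := h2
      exact Or.inr (Or.inl ⟨q, hq, e, by omega⟩)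
    · push Not at h1 h2
      exact Or.inr (Or.inr ⟨fun q hq => ⟨h1 q hq, h2 q hq⟩, rfl⟩)
  have hne : ∀ q ∈ T, ∀ r ∈ T, ∀ x, q + a = x → r + a ≠ x + 1 := by
    intro q hq r hr x e e'
    exact hgap q hq r hr (by omega)
  have hinv : Function.Involutive (clusterSwap a T) := by
    intro x
    rcases hsw x with ⟨q, hq, e, h1⟩ | ⟨q, hq, e, h1⟩ | ⟨h0, h1⟩
    · rcases hsw (clusterSwap a T x) with ⟨r, hr, e', h2⟩ | ⟨r, hr, e', h2⟩ | ⟨h0, h2⟩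
      · exact absurd e' (hne q hq r hr _ (by omega))
      · omega
      · exact absurd (by omega) (h0 q hq).2
    · rcases hsw (clusterSwap a T x) with ⟨r, hr, e', h2⟩ | ⟨r, hr, e', h2⟩ | ⟨h0, h2⟩
      · omega
      · exact absurd (by omega) (hne r hr q hq _ e')
      · exact absurd (by omega) (h0 q hq).1
    · rw [h1, h1]
  have hlt : ∀ x, x < p + m → clusterSwap a T x < p + m := by
    intro x hx
    rcases hsw x with ⟨q, hq, e, h1⟩ | ⟨q, hq, e, h1⟩ | ⟨_, h1⟩
    · have := hle q hq
      omega
    · omega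
    · omega
  have hcmp : ∀ x y, x < y → (clusterSwap a T y < clusterSwap a T x ↔
      x + 1 = y ∧ ∃ q ∈ T, q + a = y) := by
    intro x y hxy
    constructor
    · intro h
      rcases hsw x with ⟨q, hq, e, h1⟩ | ⟨q, hq, e, h1⟩ | ⟨h0, h1⟩ <;>
      rcases hsw y with ⟨r, hr, e', h2⟩ | ⟨r, hr, e', h2⟩ | ⟨h0', h2⟩ <;>
      first
      | omega
      | exact ⟨by omega, r, hr, e'⟩
    · rintro ⟨rfl, q, hq, e⟩
      rcases hsw x with ⟨r, hr, e', h2⟩ | ⟨r, hr, e', h2⟩ | ⟨h0', h2⟩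
      · rcases hsw (x + 1) with ⟨r, hr, e', h3⟩ | ⟨r, hr, e', h3⟩ | ⟨h0', h3⟩
        · exact absurd e' (hne q hq r hr _ e)
        · omega
        · exact absurd e (h0' q hq).2
      · exact absurd e (hne r hr q hq _ e')
      · exact absurd e (h0' q hq).1
  let f : Fin (p + m) → Fin (p + m) := fun x => ⟨clusterSwap a T x, hlt x x.2⟩
  have hf : Function.Involutive f := fun x => Fin.ext (hinv x)
  refine ⟨hf.toPerm, ?_, fun x y hxy => ?_⟩
  · unfold des
    symm
    refine card_bij (fun q hq => ⟨q + a - 1, by have := hle q hq; omega⟩) ?_ ?_ ?_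
    · intro q hq
      simp only [mem_filter, mem_univ, true_and]
      have := hle q hq
      refine ⟨by omega, ?_⟩
      change clusterSwap a T (q + a - 1 + 1) < clusterSwap a T (q + a - 1)
      rw [hcmp _ _ (by omega)]
      exact ⟨rfl, q, hq, by omega⟩
    · intro q hq r hr e
      simp only [Fin.mk.injEq] at e
      omega
    · rintro ⟨x, hx⟩ hx'
      simp only [mem_filter, mem_univ, true_and] at hx'
      obtain ⟨h1, h2⟩ := hx'
      change clusterSwap a T (x + 1) < clusterSwap a T x at h2
      rw [hcmp _ _ (by omega)] at h2
      obtain ⟨_, q, hq, e⟩ := h2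
      exact ⟨q, hq, Fin.ext (by simp; omega)⟩
  · have : hf.toPerm⁻¹ = hf.toPerm := by
      rw [Equiv.Perm.inv_def, hf.toPerm_symm]
    rw [this]
    exact hcmp x y hxy

-- The marked words form a single fibre of the stable sort, that of the cluster involution.
open Classical in
theorem IsCluster.coeff_card {K : Type*} [CommRing K] {p : ℕ} {T : Finset ℕ}
    (h : IsCluster m i p T) (hm : 5 ≤ m)
    (ha : 2 ≤ a) (ham : a + 2 ≤ m) (hia : i ≤ a) (hi : i + a ≤ m) (k : ℕ) :
    PowerSeries.coeff k ((tVar : Series K) ^ (#T + 1) * geom ^ (p + m + 1)) =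
      (#{w ∈ words k (p + m) | ∀ q ∈ T, WordOcc m a w q} : PowerSeries K) := by
  obtain ⟨τ, hτ, hinv⟩ := h.exists_perm hm ha ham hia hi
  rw [← hτ, coeff_card_sort_eq (by omega)]
  congr 2
  refine filter_congr fun w _ => ?_
  rw [sort_eq_iff, h.forall_wordOcc_iff hm ha ham hia hi le_rfl]
  refine forall_congr' fun x => forall_congr' fun y => imp_congr_right fun hxy => ?_
  rw [hinv x y hxy]
  exact ⟨fun h _ => h, fun h => h y.2⟩

end Clusters

/-! ### Inclusion–exclusion, one position at a time -/

section MarkedSums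

variable {K : Type*} [CommRing K] (m a : ℕ) (s : K) (k : ℕ)

open Classical in
/-- The sum over the words which have occurrences at all positions in `T`, weighted by the number of
occurrences from position `q` on. -/
noncomputable def markedSum (T : Finset ℕ) (q n : ℕ) : K :=
  ∑ w ∈ words k n with ∀ p ∈ T, WordOcc m a w p, s ^ #{p ∈ range (n + 1) | q ≤ p ∧ WordOcc m a w p}

variable {m a s k}

/-- An occurrence at `q` has weight `s = 1 + (s - 1)`: it is left unmarked or added to `T`. -/
theorem markedSum_step (T : Finset ℕ) (q n : ℕ) :
    markedSum m a s k T q n =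
      markedSum m a s k T (q + 1) n + (s - 1) * markedSum m a s k (insert q T) (q + 1) n := by
  classical
  unfold markedSum
  rw [sum_filter, sum_filter, sum_filter, mul_sum, ← sum_add_distrib]
  refine sum_congr rfl fun w _ => ?_
  by_cases hT : ∀ p ∈ T, WordOcc m a w p
  · by_cases hq : WordOcc m a w q
    · have h1 : ∀ p ∈ insert q T, WordOcc m a w p := by simpa [hq] using hT
      rw [if_pos hT, if_pos hT, if_pos h1]
      have : {p ∈ range (n + 1) | q ≤ p ∧ WordOcc m a w p} =
          insert q {p ∈ range (n + 1) | q + 1 ≤ p ∧ WordOcc m a w p} := by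
        ext p
        have := hq.1
        simp only [mem_filter, mem_range, mem_insert]
        constructor
        · rintro ⟨h1, h2, h3⟩
          rcases h2.eq_or_lt with rfl | h2
          · exact Or.inl rfl
          · exact Or.inr ⟨h1, h2, h3⟩
        · rintro (rfl | ⟨h1, h2, h3⟩)
          · exact ⟨by omega, le_rfl, hq⟩
          · exact ⟨h1, by omega, h3⟩
      rw [this, card_insert_of_notMem (by simp), pow_succ]
      ring
    · have h1 : ¬ ∀ p ∈ insert q T, WordOcc m a w p := fun h => hq (h q (by simp))
      rw [if_pos hT, if_pos hT, if_neg h1, mul_zero, add_zero]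
      congr 2
      refine filter_congr fun p _ => and_congr_left fun hp => ⟨fun h => ?_, fun h => by omega⟩
      rcases h.eq_or_lt with rfl | h
      · exact absurd hp hq
      · exact h
  · have h1 : ¬ ∀ p ∈ insert q T, WordOcc m a w p := fun h =>
      hT fun p hp => h p (mem_insert_of_mem hp)
    rw [if_neg hT, if_neg hT, if_neg h1, mul_zero, add_zero]

theorem markedSum_eq_add_sum (T : Finset ℕ) (L j n : ℕ) (hj : j ≤ L) :
    markedSum m a s k T (L - j) n = markedSum m a s k T L n +
      (s - 1) * ∑ l ∈ Icc 1 j, markedSum m a s k (insert (L - l) T) (L - l + 1) n := by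
  induction j with
  | zero => simp
  | succ j ih =>
    have e : L - (j + 1) + 1 = L - j := by omega
    rw [markedSum_step, e, ih (by omega), sum_Icc_succ_top (by omega), e]
    ring

theorem markedSum_eq_zero {T : Finset ℕ} {q n : ℕ}
    (h : ∀ w : Fin n → ℕ, ¬ ∀ p ∈ T, WordOcc m a w p) : markedSum m a s k T q n = 0 := by
  classical
  unfold markedSum
  rw [filter_false_of_mem (fun w _ => h w), sum_empty]

/-- Each window contains just one inversion. If the inversion of one occurrence lay in the window of
the other, the two inversions, and hence `p` and `q`, would coincide. For `q = p + m - l` this says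
`l ≤ min a (m - a)`. -/
theorem WordOcc.overlap {n p q : ℕ} {w : Fin n → ℕ} (hp : WordOcc m a w p) (hq : WordOcc m a w q)
    (hpq : p < q) (ha : 1 ≤ a) (ham : a < m) : p + a ≤ q ∧ p + m ≤ q + a := by
  have h1 := hp.1
  have h2 := hq.1
  constructor
  · by_contra! hlt
    have h3 := (hp.2 ⟨p + a - 1, by omega⟩ ⟨p + a, by omega⟩ (by simp; omega)
      (by rw [Fin.lt_def]; simp; omega) (by simp; omega)).2 (by simp; omega)
    rw [hq.2 _ _ (by simp; omega) (by rw [Fin.lt_def]; simp; omega) (by simp; omega)] at h3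
    simp at h3
    omega
  · by_contra! hlt
    have h3 := (hq.2 ⟨q + a - 1, by omega⟩ ⟨q + a, by omega⟩ (by simp; omega)
      (by rw [Fin.lt_def]; simp; omega) (by simp; omega)).2 (by simp; omega)
    rw [hp.2 _ _ (by simp; omega) (by rw [Fin.lt_def]; simp; omega) (by simp; omega)] at h3
    simp at h3
    omega

theorem wordOcc_comp_castAdd {L r p : ℕ} (w : Fin (L + r) → ℕ) (hp : p + m ≤ L) :
    WordOcc m a (fun x => w (Fin.castAdd r x)) p ↔ WordOcc m a w p := by
  unfold WordOcc
  refine and_congr (by omega) ⟨fun H x y hx hxy hy => ?_, fun H x y hx hxy hy => ?_⟩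
  · have : x.val < y.val := hxy
    exact H ⟨x, by omega⟩ ⟨y, by omega⟩ hx hxy hy
  · exact H (Fin.castAdd r x) (Fin.castAdd r y) hx hxy hy

theorem wordOcc_comp_natAdd {L r p : ℕ} (w : Fin (L + r) → ℕ) :
    WordOcc m a (fun x => w (Fin.natAdd L x)) p ↔ WordOcc m a w (L + p) := by
  unfold WordOcc
  refine and_congr (by omega) ⟨fun H x y hx hxy hy => ?_, fun H x y hx hxy hy => ?_⟩
  · have hxy' : x.val < y.val := hxy
    have := H ⟨x - L, by omega⟩ ⟨y - L, by omega⟩ (by simp; omega)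
      (by rw [Fin.lt_def]; simp; omega) (by simp; omega)
    have e1 : Fin.natAdd L (⟨x - L, by omega⟩ : Fin r) = x := Fin.ext (by simp; omega)
    have e2 : Fin.natAdd L (⟨y - L, by omega⟩ : Fin r) = y := Fin.ext (by simp; omega)
    simp only [e1, e2] at this
    rw [this]
    omega
  · have hxy' : x.val < y.val := hxy
    have := H (Fin.natAdd L x) (Fin.natAdd L y) (by simp; omega)
      (by rw [Fin.lt_def]; simp; omega) (by simp; omega)
    rw [this]
    simp only [Fin.val_natAdd]
    omega

-- Cut the word at `L`: the conditions in `T` concern only the prefix, the weight only the suffix.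
open Classical in
theorem markedSum_add {T : Finset ℕ} {L r : ℕ} (hT : ∀ p ∈ T, p + m ≤ L) :
    markedSum m a s k T L (L + r) =
      (#{w ∈ words k L | ∀ p ∈ T, WordOcc m a w p} : K) * markedSum m a s k ∅ 0 r := by
  unfold markedSum
  rw [← nsmul_eq_mul, ← sum_const, sum_product' _ _ (fun _ v => _) |>.symm]
  refine sum_nbij' (fun w => (fun x => w (Fin.castAdd r x), fun x => w (Fin.natAdd L x)))
    (fun u => Fin.append u.1 u.2) ?_ ?_ ?_ ?_ ?_
  · intro w hw
    simp only [mem_filter, mem_words, mem_product, notMem_empty, false_imp_iff, implies_true,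
      and_true] at hw ⊢
    exact ⟨⟨fun x => hw.1 _, fun p hp => (wordOcc_comp_castAdd w (hT p hp)).2 (hw.2 p hp)⟩,
      fun x => hw.1 _⟩
  · rintro ⟨u, v⟩ hu
    simp only [mem_filter, mem_words, mem_product, notMem_empty, false_imp_iff, implies_true,
      and_true] at hu ⊢
    refine ⟨fun x => ?_, fun p hp => (wordOcc_comp_castAdd _ (hT p hp)).1 ?_⟩
    · refine Fin.addCases (fun x => ?_) (fun x => ?_) x
      · simpa using hu.1.1 x
      · simpa using hu.2 x
    · simpa using hu.1.2 p hp
  · intro w _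
    funext x
    refine Fin.addCases (fun x => ?_) (fun x => ?_) x <;> simp
  · rintro ⟨u, v⟩ _
    simp
  · intro w _
    congr 1
    refine card_nbij' (fun p => p - L) (fun p => L + p) ?_ ?_ ?_ ?_
    · intro p hp
      simp only [coe_filter, mem_range, Set.mem_ofPred_eq, wordOcc_comp_natAdd] at hp ⊢
      rw [Nat.add_sub_cancel' hp.2.1]
      exact ⟨by omega, by omega, hp.2.2⟩
    · intro p hp
      simp only [coe_filter, mem_range, Set.mem_ofPred_eq, wordOcc_comp_natAdd] at hp ⊢
      exact ⟨by omega, by omega, hp.2.2⟩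
    · intro p hp
      simp only [coe_filter, mem_range, Set.mem_ofPred_eq] at hp
      simp only
      omega
    · intro p hp
      simp

end MarkedSums

/-! ### The rational generating function of clusters -/

section TransferSeries

variable {K : Type*} [CommRing K]

/-- `1 / (1 - u t ∑ z ^ (m - l))` -/
noncomputable def overlapSeries (m i : ℕ) (U : Series K) : Series K :=
  Ring.inverse (1 - U * tVar * ∑ l ∈ Icc 1 i, zVar ^ (m - l))

theorem isUnit_overlap (m i : ℕ) (U : Series K) :
    IsUnit (1 - U * tVar * ∑ l ∈ Icc 1 i, zVar ^ (m - l)) := by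
  have := isUnit_one_sub_tVar_mul (U * ∑ l ∈ Icc 1 i, zVar ^ (m - l))
  rwa [← mul_assoc, mul_comm tVar] at this

theorem overlapSeries_eq (m i : ℕ) (U : Series K) : overlapSeries m i U =
    1 + U * tVar * (∑ l ∈ Icc 1 i, zVar ^ (m - l)) * overlapSeries m i U := by
  have := Ring.mul_inverse_cancel _ (isUnit_overlap m i U)
  change _ * overlapSeries m i U = 1 at this
  linear_combination this

/-- The generating function of the continuations of a cluster of `r` occurrences and length `L`. -/
noncomputable def clusterSeries (m i : ℕ) (U : Series K) (r L : ℕ) : Series K :=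
  tVar ^ (r + 1) * zVar ^ L * geom * overlapSeries m i U

/-- A cluster either ends here or gains an occurrence sharing `l` letters, which makes its length `L
+ m - l`. -/
theorem clusterSeries_eq {m i : ℕ} (him : i < m) (U : Series K) (r L : ℕ) :
    clusterSeries m i U r L = tVar ^ (r + 1) * zVar ^ L * geom +
      U * ∑ l ∈ Icc 1 i, clusterSeries m i U (r + 1) (L + m - l) := by
  have : ∀ l ∈ Icc 1 i, clusterSeries m i U (r + 1) (L + m - l) =
      tVar * zVar ^ (m - l) * clusterSeries m i U r L := by
    intro l hl
    rw [mem_Icc] at hl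
    rw [clusterSeries, clusterSeries, Nat.add_sub_assoc (by omega)]
    ring
  rw [sum_congr rfl this, ← sum_mul, ← mul_sum]
  unfold clusterSeries
  linear_combination tVar ^ (r + 1) * zVar ^ L * geom * overlapSeries_eq m i U

theorem coeff_zVar_pow_mul (L k : ℕ) (f : Series K) :
    PowerSeries.coeff k (zVar ^ L * f) =
      PowerSeries.X ^ L * PowerSeries.coeff k (geom ^ L * f) := by
  rw [zVar, mul_pow, mul_assoc, xVar, ← map_pow, PowerSeries.coeff_C_mul]

theorem coeff_C_C_mul (c : K) (f : Series K) (k : ℕ) :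
    PowerSeries.coeff k (PowerSeries.C (PowerSeries.C c) * f) =
      PowerSeries.C c * PowerSeries.coeff k f := by
  rw [PowerSeries.coeff_C_mul]

theorem coeff_clusterSeries_eq_zero {m i : ℕ} (U : Series K) (r L k n : ℕ) (h : n < L) :
    PowerSeries.coeff n (PowerSeries.coeff k (clusterSeries m i U r L)) = 0 := by
  rw [clusterSeries, mul_assoc, mul_assoc, mul_left_comm, coeff_zVar_pow_mul,
    PowerSeries.coeff_X_pow_mul', if_neg (by omega)]

end TransferSeries

/-! ### The cluster method for words -/

section WordSeries

variable {K : Type*} [CommRing K] {m a i : ℕ} {s : K} {k : ℕ}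

variable (m a s k) in
/-- The generating function of the words in `k` letters by length and number of occurrences. -/
noncomputable def wordSeries : PowerSeries K := PowerSeries.mk fun n => markedSum m a s k ∅ 0 n

/-- A cluster under construction is followed by all its continuations and then by an arbitrary word.
The recursion ends because the last start `p` grows while the word length `n` bounds it. -/
theorem coeff_wordSeries_mul_cluster {p : ℕ} {T : Finset ℕ} (h : IsCluster m i p T) (hm : 5 ≤ m)
    (ha : 2 ≤ a) (ham : a + 2 ≤ m) (hi : i = min a (m - a)) (n : ℕ) :
    markedSum m a s k T (p + 1) n = PowerSeries.coeff n (wordSeries m a s k * PowerSeries.coeff k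
      (clusterSeries m i (PowerSeries.C (PowerSeries.C (s - 1))) #T (p + m))) := by
  classical
  have him : i < m := by omega
  by_cases hn : n < p + m
  · rw [markedSum_eq_zero fun w hw => absurd (hw p h.mem).1 (by omega), PowerSeries.coeff_mul]
    symm
    refine sum_eq_zero fun x hx => ?_
    rw [HasAntidiagonal.mem_antidiagonal] at hx
    rw [coeff_clusterSeries_eq_zero _ _ _ _ _ (by omega), mul_zero]
  · obtain ⟨r, rfl⟩ : ∃ r, n = p + m + r := ⟨n - (p + m), by omega⟩
    have e : p + 1 = p + m - (m - 1) := by omega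
    -- Either no start in `p + 1, …, p + m - 1` is marked and the word factors at `p + m`, or the
    -- first marked one there extends the cluster.
    rw [e, markedSum_eq_add_sum _ _ _ _ (by omega),
      markedSum_add (fun q hq => by have := h.le him hq; omega), clusterSeries_eq him]
    have hsub : ∑ l ∈ Icc 1 (m - 1), markedSum m a s k (insert (p + m - l) T) (p + m - l + 1)
          (p + m + r) =
        ∑ l ∈ Icc 1 i, markedSum m a s k (insert (p + m - l) T) (p + m - l + 1) (p + m + r) := by
      symm
      refine sum_subset (Icc_subset_Icc_right (by omega)) fun l hl hl' => ?_
      rw [mem_Icc] at hl hl'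
      refine markedSum_eq_zero fun w hw => ?_
      have hp := hw p (mem_insert_of_mem h.mem)
      have hq := hw (p + m - l) (mem_insert_self _ _)
      have h3 := hp.overlap hq (by omega) (by omega) (by omega)
      omega
    rw [hsub]
    have hsum : ∀ l ∈ Icc 1 i, markedSum m a s k (insert (p + m - l) T) (p + m - l + 1)
        (p + m + r) = PowerSeries.coeff (p + m + r) (wordSeries m a s k * PowerSeries.coeff k
          (clusterSeries m i (PowerSeries.C (PowerSeries.C (s - 1))) (#T + 1) (p + m + m - l))) := by
      intro l hl
      have hl' := mem_Icc.1 hl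
      rw [coeff_wordSeries_mul_cluster (h.insert hl) hm ha ham hi,
        card_insert_of_notMem (h.notMem him (by omega)),
        show p + m - l + m = p + m + m - l by omega]
    rw [sum_congr rfl hsum, map_add, mul_add, map_add, coeff_C_C_mul, mul_left_comm,
      PowerSeries.coeff_C_mul, map_sum, mul_sum (a := wordSeries m a s k), map_sum]
    congr 1
    rw [show (tVar : Series K) ^ (#T + 1) * zVar ^ (p + m) * geom =
      zVar ^ (p + m) * (tVar ^ (#T + 1) * geom) by ring, coeff_zVar_pow_mul,
      show (geom : Series K) ^ (p + m) * (tVar ^ (#T + 1) * geom) =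
      tVar ^ (#T + 1) * geom ^ (p + m + 1) by ring,
      h.coeff_card hm ha ham (by omega) (by omega), ← map_natCast (PowerSeries.C (R := K)),
      mul_comm (PowerSeries.X ^ _), mul_left_comm, PowerSeries.coeff_C_mul, add_comm (p + m) r,
      PowerSeries.coeff_mul_X_pow, wordSeries, PowerSeries.coeff_mk]
termination_by n - p
decreasing_by
  rw [mem_Icc] at *
  omega

/-- A nonempty word begins either with a free letter (`k` choices), when position `0` is unmarked,
or with a cluster. -/
theorem wordSeries_mul (hm : 5 ≤ m) (ha : 2 ≤ a) (ham : a + 2 ≤ m) (hi : i = min a (m - a)) :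
    wordSeries m a s k * (1 - ((k : PowerSeries K) * PowerSeries.X + PowerSeries.C (s - 1) * PowerSeries.coeff k
      (clusterSeries m i (PowerSeries.C (PowerSeries.C (s - 1))) 1 m))) = 1 := by
  classical
  suffices h : wordSeries m a s k = 1 + PowerSeries.X * ((k : PowerSeries K) * wordSeries m a s k) +
      PowerSeries.C (s - 1) * (wordSeries m a s k * PowerSeries.coeff k
        (clusterSeries m i (PowerSeries.C (PowerSeries.C (s - 1))) 1 m)) by
    linear_combination h
  ext n
  have h1 := coeff_wordSeries_mul_cluster (s := s) (k := k) IsCluster.single hm ha ham hi n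
  rw [zero_add, zero_add, card_singleton] at h1
  rw [map_add, PowerSeries.coeff_C_mul, ← h1, map_add]
  nth_rw 1 [wordSeries]
  rw [PowerSeries.coeff_mk, markedSum_step, zero_add, insert_empty]
  congr 1
  cases n with
  | zero =>
    simp [markedSum, words, filter_singleton]
  | succ n =>
    rw [PowerSeries.coeff_succ_X_mul, ← map_natCast (PowerSeries.C (R := K)),
      PowerSeries.coeff_C_mul, add_comm n 1, markedSum_add (by simp), wordSeries,
      PowerSeries.coeff_mk]
    simp [words, PowerSeries.coeff_one]

end WordSeries

/-! ### Passing to coefficients of `t` and summing -/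

section FormalSums

variable {K : Type*} [CommRing K]

theorem coeff_geom (k : ℕ) : PowerSeries.coeff k (geom : Series K) = 1 := by
  have := coeff_chainCount (K := K) (fun _ => 1) rfl (fun _ => le_rfl) 0 k
  simpa [chainCount_zero] using this

theorem coeff_hadamardPow (f : Series K) (n k : ℕ) :
    PowerSeries.coeff k (hadamardPow f n) = PowerSeries.coeff k f ^ n := by
  induction n with
  | zero => rw [hadamardPow, coeff_geom, pow_zero]
  | succ n ih => rw [hadamardPow, hadamard, PowerSeries.coeff_mk, ih, pow_succ]

/-- For each `k` this is an ordinary geometric series in `x`, whose remainder after `N` terms is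
divisible by `x^N`. -/
theorem isFormalSum_hadamardPow {f F : Series K} (h0 : ∀ k, PowerSeries.X ∣ PowerSeries.coeff k f)
    (h : ∀ k, PowerSeries.coeff k F * (1 - PowerSeries.coeff k f) = 1) :
    IsFormalSum (fun n => hadamardPow f n) F := by
  intro k j
  filter_upwards [Filter.eventually_gt_atTop j] with N hN
  simp only [map_sum, coeff_hadamardPow]
  rw [← map_sum]
  have hs : PowerSeries.coeff k F = ∑ n ∈ range N, PowerSeries.coeff k f ^ n +
      PowerSeries.coeff k f ^ N * PowerSeries.coeff k F := by
    have h1 := mul_neg_geom_sum (PowerSeries.coeff k f) N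
    linear_combination (-PowerSeries.coeff k F) * h1 +
      (∑ n ∈ range N, PowerSeries.coeff k f ^ n) * h k
  rw [hs]
  have hd : PowerSeries.X ^ N ∣ PowerSeries.coeff k f ^ N * PowerSeries.coeff k F :=
    (pow_dvd_pow_of_dvd (h0 k) N).mul_right _
  rw [map_add, PowerSeries.X_pow_dvd_iff.1 hd j hN, add_zero]

variable {m a i : ℕ} {s : K}

theorem inverse_pow (n : ℕ) : Ring.inverse ((1 - tVar : Series K) ^ n) = geom ^ n :=
  (Ring.inverse_pow _ n).symm

theorem occ_transPattern (ha : 1 ≤ a) (ham : a < m) {n : ℕ} (w : Fin n → ℕ)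
    [DecidablePred fun p => WordOcc m a w p] :
    occ (transPattern m a ha ham) (Tuple.sort w)⁻¹ = #{p ∈ range (n + 1) | WordOcc m a w p} := by
  unfold occ
  congr 1
  refine filter_congr fun p _ => ?_
  rw [isOccurrence_transPattern_iff, wordOcc_sort_inv_iff]

/-- Group the words by the inverse `π` of their stable sort; `occ` is constant on each class, and
the class size is read off from `des π⁻¹ = ides π`. -/
theorem coeff_idesPoly_mul (ha : 1 ≤ a) (ham : a < m) (n k : ℕ) :
    PowerSeries.coeff k (idesPoly (transPattern m a ha ham) n
      (PowerSeries.C (PowerSeries.C s) : Series K) tVar * geom ^ (n + 1)) =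
      PowerSeries.C (markedSum m a s k ∅ 0 n) := by
  classical
  by_cases hn : n = 0
  · subst hn
    have h1 : ∀ w : Fin 0 → ℕ, ¬ WordOcc m a w 0 := fun w h => by
      have := h.1
      omega
    simp [idesPoly, coeff_geom, markedSum, words, filter_singleton, h1]
  · rw [idesPoly, if_neg hn, sum_mul, map_sum, markedSum]
    simp only [notMem_empty, false_imp_iff, implies_true, filter_true, zero_le, true_and]
    rw [← sum_fiberwise _ fun w => (Tuple.sort w)⁻¹, map_sum]
    refine sum_congr rfl fun π _ => ?_
    have h1 : ∀ w ∈ {w ∈ words k n | (Tuple.sort w)⁻¹ = π},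
        s ^ #{p ∈ range (n + 1) | WordOcc m a w p} = s ^ occ (transPattern m a ha ham) π := by
      intro w hw
      rw [mem_filter] at hw
      rw [← hw.2, occ_transPattern]
    rw [sum_congr rfl h1, sum_const, mul_assoc, ← map_pow, ← map_pow, PowerSeries.coeff_C_mul,
      ides, coeff_card_sort_eq hn, nsmul_eq_mul, map_mul, map_natCast, mul_comm]
    congr 3
    refine filter_congr fun w _ => ?_
    rw [inv_eq_iff_eq_inv]

theorem isFormalSum_idesPoly (ha : 1 ≤ a) (ham : a < m) :
    IsFormalSum (fun n => idesPoly (transPattern m a ha ham) n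
      (PowerSeries.C (PowerSeries.C s) : Series K) tVar * Ring.inverse ((1 - tVar) ^ (n + 1)) *
        xVar ^ n) (PowerSeries.mk fun k => wordSeries m a s k) := by
  intro k j
  filter_upwards [Filter.eventually_gt_atTop j] with N hN
  rw [map_sum, map_sum, PowerSeries.coeff_mk, wordSeries, PowerSeries.coeff_mk]
  have h1 : ∀ n, PowerSeries.coeff j (PowerSeries.coeff k
      (idesPoly (transPattern m a ha ham) n (PowerSeries.C (PowerSeries.C s) : Series K) tVar *
        Ring.inverse ((1 - tVar) ^ (n + 1)) * xVar ^ n)) =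
      if j = n then markedSum m a s k ∅ 0 n else 0 := by
    intro n
    rw [inverse_pow, xVar, ← map_pow, PowerSeries.coeff_mul_C, coeff_idesPoly_mul,
      PowerSeries.coeff_C_mul, PowerSeries.coeff_X_pow, mul_ite, mul_one, mul_zero]
  rw [sum_congr rfl fun n _ => h1 n, sum_ite_eq, if_pos (mem_range.2 hN)]

theorem chainCount_one (e : ℕ → ℕ) (k : ℕ) : chainCount e 1 k = k := by
  classical
  unfold chainCount
  rw [filter_true_of_mem fun v _ x y hxy => by omega]
  simp [words]

theorem coeff_tVar_mul_xVar (k : ℕ) :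
    PowerSeries.coeff k (tVar * xVar * Ring.inverse ((1 - tVar : Series K) ^ 2)) =
      (k : PowerSeries K) * PowerSeries.X := by
  rw [inverse_pow, mul_right_comm, xVar, PowerSeries.coeff_mul_C]
  congr 1
  have h := coeff_chainCount (K := K) (fun _ => 1) rfl (fun _ => le_rfl) 1 k
  simp only [range_one, sum_singleton, pow_one] at h
  rw [h, chainCount_one]

theorem isFormalSum_clusters (hm : 5 ≤ m) (ha : 2 ≤ a) (ham : a + 2 ≤ m)
    (hi : i = min a (m - a)) {U : Series K} (hU : U = PowerSeries.C (PowerSeries.C (s - 1))) :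
    IsFormalSum (fun n => hadamardPow
      (tVar * xVar * Ring.inverse ((1 - tVar) ^ 2) +
        U * tVar ^ 2 * zVar ^ m * Ring.inverse
          ((1 - tVar) * (1 - U * tVar * ∑ l ∈ Finset.Icc 1 i, zVar ^ (m - l)))) n)
      (PowerSeries.mk fun k => wordSeries m a s k) := by
  have h : ∀ k, PowerSeries.coeff k (tVar * xVar * Ring.inverse ((1 - tVar) ^ 2) +
        U * tVar ^ 2 * zVar ^ m * Ring.inverse
          ((1 - tVar) * (1 - U * tVar * ∑ l ∈ Finset.Icc 1 i, zVar ^ (m - l)))) =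
      (k : PowerSeries K) * PowerSeries.X + PowerSeries.C (s - 1) *
        PowerSeries.coeff k (clusterSeries m i (PowerSeries.C (PowerSeries.C (s - 1))) 1 m) := by
    intro k
    rw [map_add, coeff_tVar_mul_xVar, Ring.mul_inverse_rev, ← coeff_C_C_mul, ← hU, clusterSeries,
      overlapSeries, geom]
    congr 2
    ring
  refine isFormalSum_hadamardPow (fun k => ?_) fun k => ?_
  · rw [h]
    refine dvd_add (dvd_mul_left _ _) (Dvd.dvd.mul_left ?_ _)
    rw [PowerSeries.X_dvd_iff, ← PowerSeries.coeff_zero_eq_constantCoeff_apply]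
    exact coeff_clusterSeries_eq_zero _ _ _ _ _ (by omega)
  · rw [h, PowerSeries.coeff_mk, wordSeries_mul hm ha ham hi]

theorem idesPoly_zero_left {R : Type*} [CommSemiring R] (σ : Equiv.Perm (Fin m)) {n : ℕ}
    (hn : n ≠ 0) (t : R) :
    idesPoly σ n 0 t = ∑ π : Equiv.Perm (Fin n) with Avoids σ π, t ^ (ides π + 1) := by
  rw [idesPoly, if_neg hn, sum_filter]
  refine sum_congr rfl fun π _ => ?_
  unfold Avoids
  split_ifs with h <;> simp [h]

end FormalSums
end TransIdes

open TransIdes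
theorem theorem5p2 (m a i : ℕ) (hm : 5 ≤ m) (ha : 2 ≤ a) (ham : a + 2 ≤ m)
    (hi : i = min a (m - a)) (σ : Equiv.Perm (Fin m))
    (hσ : σ = transPattern m a (by omega) (by omega)) :
    -- (a): an identity of formal power series in `t`, `x` over `ℚ[s]`
    (∃ F : Series (Polynomial ℚ),
      IsFormalSum (fun n =>
        idesPoly σ n sVar tVar * Ring.inverse ((1 - tVar) ^ (n + 1)) * xVar ^ n) F ∧
      IsFormalSum (fun n => hadamardPow
        (tVar * xVar * Ring.inverse ((1 - tVar) ^ 2) +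
          (sVar - 1) * tVar ^ 2 * zVar ^ m * Ring.inverse
            ((1 - tVar) * (1 - (sVar - 1) * tVar * ∑ l ∈ Finset.Icc 1 i, zVar ^ (m - l)))) n) F) ∧
    -- (b): the specialization `s = 0`, over `ℚ`
    (∃ F : Series ℚ,
      IsFormalSum (fun n =>
        idesPoly σ n 0 tVar * Ring.inverse ((1 - tVar) ^ (n + 1)) * xVar ^ n) F ∧
      IsFormalSum (fun n => hadamardPow
        (tVar * xVar * Ring.inverse ((1 - tVar) ^ 2) -
          tVar ^ 2 * zVar ^ m * Ring.inverse
            ((1 - tVar) * (1 + tVar * ∑ l ∈ Finset.Icc 1 i, zVar ^ (m - l)))) n) F) ∧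
    -- `A_{σ,n}(0,t)` is the distribution of `ides` over the permutations that avoid `σ`
    (∀ n : ℕ, 1 ≤ n → idesPoly σ n 0 (Polynomial.X : Polynomial ℚ) =
      ∑ π : Equiv.Perm (Fin n) with Avoids σ π, Polynomial.X ^ (ides π + 1)) := by
  subst hσ
  refine ⟨⟨_, isFormalSum_idesPoly _ _,
    isFormalSum_clusters (s := Polynomial.X) hm ha ham hi (by simp [sVar])⟩, ?_,
    fun n hn => idesPoly_zero_left _ (by omega) _⟩
  have h1 := isFormalSum_idesPoly (K := ℚ) (m := m) (a := a) (s := 0) (by omega) (by omega)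
  -- At `s = 0` the weight `s - 1` of a mark is `-1`, which produces the signs in (b).
  have h2 := isFormalSum_clusters (K := ℚ) (s := 0) (U := -1) hm ha ham hi (by simp)
  simp only [map_zero] at h1
  simp only [neg_mul, one_mul, ← sub_eq_add_neg, sub_neg_eq_add] at h2
  exact ⟨_, h1, h2⟩
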